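/- Let $\mathsf{E}_8\subset\mathbb{R}^8$ be the set of the $240$ shortest vectors of the $E_8$ lattice, that is, the vectors $\pm e_i\pm e_j$ with $1\le i<j\le 8$ together with the vectors $(\pm\tfrac12,\dots,\pm\tfrac12)$ having an even number of minus signs, and let $\mathsf{E}_7=\{a\in\mathsf{E}_8 : a_7=a_8\}$, the set of shortest vectors of the $E_7$ lattice. It has $126$ elements and lies in the hyperplane $T=\{Y_7=Y_8\}$. Use $Y_1,\dots,Y_7$ as coordinates on $T$, so that polynomials on $T$ are the elements of $\mathbb{C}[Y_1,\dots,Y_7]$ and a polynomial in $Y_1,\dots,Y_8$ is restricted to $T$ by substituting $Y_8=Y_7$; zeros are taken in the complex points of $T$. Let $\mathcal{I}(\mathsf{E}_7)\subset\mathbb{C}[Y_1,\dots,Y_7]$ be the ideal of all polynomials on $T$ that vanish on $\mathsf{E}_7$. Let $\mathsf{Nm}=Y_1^2+\dots+Y_8^2-2$; a polynomial on $T$ is called trivial if it is a multiple of the restriction of $\mathsf{Nm}$ to $T$. There are exactly $56$ vectors $b\in\mathsf{E}_8$ with $b_7-b_8=1$; for each of them put $C_b(Y)=(b\cdot Y-1)(b\cdot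 Y)(b\cdot Y+1)$. Let $\mathsf{I}\subset\mathbb{C}[Y_1,\dots,Y_7]$ be the ideal generated by the restrictions to $T$ of $\mathsf{Nm}$ and of these $56$ cubics $C_b$. Theorem 3.2. (i) The zero set of $\mathsf{I}$ is exactly $\mathsf{E}_7$. (ii) $\mathsf{I}$ is a radical ideal. (iii) The smallest degree of a non-trivial polynomial in $\mathcal{I}(\mathsf{E}_7)$ is $3$. (iv) $\mathcal{I}(\mathsf{E}_7)$ is generated by a set of polynomials all of degree at most $3$. -/

import Mathlib

namespace E7Ideal

noncomputable section

open MvPolynomial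

/-- The 240 shortest vectors of the `E₈` lattice in `ℝ⁸`: the vectors `± e_i ± e_j` with `i ≠ j`,
and the vectors `(± 1/2, …, ± 1/2)` with an even number of minus signs
(`s` is the set of positions of the minus signs). -/
def E8 : Set (Fin 8 → ℝ) :=
  {a | ∃ i j : Fin 8, i ≠ j ∧ ∃ ε δ : ℝ, (ε = 1 ∨ ε = -1) ∧ (δ = 1 ∨ δ = -1) ∧
      a = Pi.single i ε + Pi.single j δ} ∪
  {a | ∃ s : Finset (Fin 8), Even s.card ∧ a = fun i => if i ∈ s then -1 / 2 else 1 / 2}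

/-- The shortest vectors of the `E₇` lattice, as the vectors of `E8` whose seventh and eighth
coordinates agree (coordinates are numbered from `0` here). -/
def E7 : Set (Fin 8 → ℝ) :=
  {a | a ∈ E8 ∧ a 6 = a 7}

/-- The vectors `b` of `E8` with `b₇ - b₈ = 1`. -/
def cubicVectors : Set (Fin 8 → ℝ) :=
  {b | b ∈ E8 ∧ b 6 - b 7 = 1}

/-- `Nm = Y₁² + ⋯ + Y₈² - 2`, the equation of the sphere that contains `E8`. -/
def Nm : MvPolynomial (Fin 8) ℂ :=
  ∑ i, X i ^ 2 - C 2

/-- The linear form `b · Y = b₁ Y₁ + ⋯ + b₈ Y₈`. -/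
def linearForm (b : Fin 8 → ℝ) : MvPolynomial (Fin 8) ℂ :=
  ∑ i, C (b i : ℂ) * X i

/-- The zonal cubic `C_b(Y) = (b · Y - 1) (b · Y) (b · Y + 1)`. -/
def cubic (b : Fin 8 → ℝ) : MvPolynomial (Fin 8) ℂ :=
  (linearForm b - 1) * linearForm b * (linearForm b + 1)

/-- The hyperplane `T = {Y₇ = Y₈}` of `8`-space has the linear coordinates `Y₁, …, Y₇`: the
point `y` of `7`-space stands for the point `y ∘ hyperplaneIndex = (y₁, …, y₆, y₇, y₇)` of `T`. -/
def hyperplaneIndex : Fin 8 → Fin 7 :=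
  ![0, 1, 2, 3, 4, 5, 6, 6]

/-- Restriction of polynomials to the hyperplane `T`: the substitution `Y₈ := Y₇`. -/
def restrict : MvPolynomial (Fin 8) ℂ →ₐ[ℂ] MvPolynomial (Fin 7) ℂ :=
  rename hyperplaneIndex

/-- The set `E7`, which lies in `T`, in the coordinates `Y₁, …, Y₇` of `T`
(as a set of points with complex coordinates). -/
def E7InT : Set (Fin 7 → ℂ) :=
  {y | ∃ a ∈ E7, ∀ i, y (hyperplaneIndex i) = (a i : ℂ)}

/-- The ideal of polynomials on `T` generated by the restrictions of `Nm` and of the cubics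
`C_b`, for `b ∈ E8` with `b₇ - b₈ = 1`. -/
def cubicIdeal : Ideal (MvPolynomial (Fin 7) ℂ) :=
  Ideal.span (insert (restrict Nm) ((fun b => restrict (cubic b)) '' cubicVectors))

/-- The ideal `I(E7)` of all polynomials on `T` that vanish on `E7`. -/
def idealOfE7 : Ideal (MvPolynomial (Fin 7) ℂ) :=
  vanishingIdeal ℂ E7InT

/-- A polynomial on `T` is trivial if it is a multiple of the equation of the sphere. -/
def IsTrivial (F : MvPolynomial (Fin 7) ℂ) : Prop :=
  restrict Nm ∣ F

end

end E7Ideal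

/-!
The cubic `C_b = x³ - x`, with `x = b · Y`, says that `b · Y` takes only the values `-1, 0, 1`.

Radicality is a matter of separability. In the quotient by the ideal every form `x = b · Y`
satisfies `x³ = x`, so `(3 x² - 1) dx = 0`, and `3 x² - 1` is a unit; hence `dx = 0`. The forms
`Y₇ ± Y_i` that come from `b = e₇ ± e_i` span all linear forms on `T`, so the module of
differentials of the quotient is zero: the quotient is formally unramified over `ℂ`, hence reduced
(`isRadical_of_derivation_eq_zero`, `isRadical_cubicIdeal`).

The zero set is found by hand (`zeroLocus_cubicIdeal`). An inner product of `a ∈ E7` with one of the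
`b` is an integer of absolute value at most `2`, and `± 2` would force `b = ± a`. Conversely, the
cubics of `e₇ ± e_i` leave for `y₇` and `y_i` only a few half-integral values, which the equation of
the sphere and, for the points with coordinates `± 1/2`, the cubics of the half-integral `b` cut
down to `E7`.

By the Nullstellensatz the ideal is therefore the ideal of all polynomials that vanish on `E7`
(`idealOfE7_eq_cubicIdeal`), and its generators have degree at most `3`. A polynomial of degree at
most `2` that vanishes on `E7` is a multiple of the equation of the sphere by comparison of
coefficients (`isTrivial_of_totalDegree_le_two`), whereas a cubic `C_b` is not, because it does not
vanish on the whole sphere.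
-/

namespace E7Ideal

open MvPolynomial

/-! ### Radicality -/

/-- The cubic `t³ - t` is separable, so a root of it in an algebra over `ℂ` is killed by every
derivation. -/
theorem derivation_eq_zero_of_cubic_eq_zero {R M : Type*} [CommRing R] [Algebra ℂ R]
    [AddCommGroup M] [Module R M] [Module ℂ M] [IsScalarTower ℂ R M] (D : Derivation ℂ R M) {x : R}
    (hx : (x - 1) * x * (x + 1) = 0) : D x = 0 := by
  have h3 : x ^ 3 = x := by linear_combination hx
  have hD : (3 * x ^ 2 - 1) • D x = 0 := by
    have := congrArg D h3
    rw [D.leibniz_pow] at this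
    rw [← Nat.cast_smul_eq_nsmul R, smul_smul] at this
    rw [sub_smul, one_smul, sub_eq_zero]
    exact_mod_cast this
  -- At the roots `0, 1, -1` of `t³ - t` the values of `3 t² - 2` are twice the inverses of those
  -- of the derivative `3 t² - 1`.
  have hu : (3 * x ^ 2 - 2) * (3 * x ^ 2 - 1) = (2 : R) := by linear_combination (9 * x) * h3
  have h2 : (2 : ℂ) • D x = 0 := by
    rw [← algebraMap_smul R, map_ofNat, ← hu, mul_smul, hD, smul_zero]
  exact (smul_eq_zero.1 h2).resolve_left two_ne_zero

/-- If the differentials of the coordinates vanish in the quotient by `I`, then the quotient is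
formally unramified over `ℂ`, hence reduced. -/
theorem isRadical_of_derivation_eq_zero {σ : Type*} [Finite σ] (I : Ideal (MvPolynomial σ ℂ))
    (h : ∀ i, KaehlerDifferential.D ℂ (MvPolynomial σ ℂ ⧸ I) (Ideal.Quotient.mk I (X i)) = 0) :
    I.IsRadical := by
  have hD : ∀ x, KaehlerDifferential.D ℂ (MvPolynomial σ ℂ ⧸ I) x = 0 := by
    intro x
    obtain ⟨p, rfl⟩ := Ideal.Quotient.mk_surjective x
    induction p using MvPolynomial.induction_on with
    | C a => exact Derivation.map_algebraMap _ a
    | add p q hp hq => rw [map_add, map_add, hp, hq, add_zero]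
    | mul_X p i hp => rw [map_mul, Derivation.leibniz, hp, h, smul_zero, smul_zero, add_zero]
  have hsub : Subsingleton (Ω[MvPolynomial σ ℂ ⧸ I⁄ℂ]) := by
    rw [← Submodule.subsingleton_iff (MvPolynomial σ ℂ ⧸ I), ← subsingleton_iff_bot_eq_top,
      ← KaehlerDifferential.span_range_derivation, eq_comm, Submodule.span_eq_bot]
    rintro _ ⟨x, rfl⟩
    exact hD x
  have : Algebra.FormallyUnramified ℂ (MvPolynomial σ ℂ ⧸ I) := ⟨hsub⟩
  rw [Ideal.isRadical_iff_quotient_reduced]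
  exact Algebra.FormallyUnramified.isReduced_of_field ℂ _

/-! ### Points and vectors -/

theorem aeval_restrict_cubic (y : Fin 7 → ℂ) (b : Fin 8 → ℝ) :
    aeval y (restrict (cubic b)) =
      (∑ i, (b i : ℂ) * y (hyperplaneIndex i) - 1) * (∑ i, (b i : ℂ) * y (hyperplaneIndex i)) *
        (∑ i, (b i : ℂ) * y (hyperplaneIndex i) + 1) := by
  simp [restrict, cubic, linearForm]

theorem aeval_restrict_Nm (y : Fin 7 → ℂ) :
    aeval y (restrict Nm) = ∑ i, y (hyperplaneIndex i) ^ 2 - 2 := by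
  simp [restrict, Nm]

theorem pair_mem_cubicVectors {i : Fin 7} (hi : i ≠ 6) {ε : ℝ} (hε : ε = 1 ∨ ε = -1) :
    Pi.single i.castSucc ε + Pi.single 6 1 ∈ cubicVectors := by
  have h6 : i.castSucc ≠ 6 := by revert i; decide
  have h7 : i.castSucc ≠ 7 := by revert i; decide
  exact ⟨Or.inl ⟨_, _, h6, ε, 1, hε, Or.inl rfl, rfl⟩, by simp [h6.symm, h7.symm]⟩

theorem sum_pair_mul (y : Fin 7 → ℂ) (i : Fin 7) (hi : i ≠ 6) (ε : ℝ) :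
    ∑ k, (((Pi.single i.castSucc ε + Pi.single 6 1 : Fin 8 → ℝ) k : ℝ) : ℂ) *
      y (hyperplaneIndex k) =
      ε * y i + y 6 := by
  have hi' : hyperplaneIndex i.castSucc = i := by revert i; decide
  simp [Pi.single_apply, add_mul, Finset.sum_add_distrib, hi', apply_ite (Complex.ofReal)]
  rfl

theorem single_mem_E7InT {ε : ℝ} (hε : ε = 1 ∨ ε = -1) :
    (Pi.single 6 (ε : ℂ) : Fin 7 → ℂ) ∈ E7InT := by
  refine ⟨Pi.single 6 ε + Pi.single 7 ε,
    ⟨Or.inl ⟨6, 7, by decide, ε, ε, hε, hε, rfl⟩, by simp⟩, fun k => ?_⟩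
  fin_cases k <;> simp [hyperplaneIndex]

theorem pair_mem_E7InT {i j : Fin 7} (hi : i ≠ 6) (hj : j ≠ 6) (hij : i ≠ j) {ε δ : ℝ}
    (hε : ε = 1 ∨ ε = -1) (hδ : δ = 1 ∨ δ = -1) :
    (Pi.single i (ε : ℂ) + Pi.single j (δ : ℂ) : Fin 7 → ℂ) ∈ E7InT := by
  have h : ∀ i : Fin 7, i ≠ 6 → ∀ k, hyperplaneIndex k = i ↔ k = i.castSucc := by decide
  have h6 : ∀ i : Fin 7, i ≠ 6 → 6 ≠ i.castSucc ∧ 7 ≠ i.castSucc := by decide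
  refine ⟨Pi.single i.castSucc ε + Pi.single j.castSucc δ,
    ⟨Or.inl ⟨_, _, by simpa using hij, ε, δ, hε, hδ, rfl⟩, ?_⟩, fun k => ?_⟩
  · simp [h6 i hi, h6 j hj]
  · simp [Pi.single_apply, h i hi, h j hj, apply_ite (Complex.ofReal)]

theorem half_mem_E7InT {s : Finset (Fin 7)} (hs : Even (s.erase 6).card) :
    (fun i => if i ∈ s then -1 / 2 else 1 / 2 : Fin 7 → ℂ) ∈ E7InT := by
  have key : ∀ s : Finset (Fin 7), Even (s.erase 6).card →
      Even (Finset.univ.filter fun k => hyperplaneIndex k ∈ s).card := by decide +kernel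
  refine ⟨fun k => if hyperplaneIndex k ∈ s then -1 / 2 else 1 / 2,
    ⟨Or.inr ⟨Finset.univ.filter fun k => hyperplaneIndex k ∈ s, key s hs, ?_⟩, rfl⟩, fun k => ?_⟩
  · simp
  · simp only [apply_ite (Complex.ofReal)]
    norm_num

/-! ### Inner products and cardinalities -/

/-- The vector `ε e_i + δ e_j` for `p = (i, j, ε, δ)`. -/
def pairVector {R : Type*} [AddZeroClass R] (p : Fin 8 × Fin 8 × R × R) : Fin 8 → R :=
  Pi.single p.1 p.2.2.1 + Pi.single p.2.1 p.2.2.2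

/-- The vector `(± 1/2, …, ± 1/2)` whose negative entries are those indexed by `s`. -/
noncomputable def halfVector (s : Finset (Fin 8)) : Fin 8 → ℝ :=
  fun i => if i ∈ s then -1 / 2 else 1 / 2

theorem sum_sq_of_mem_E8 {a : Fin 8 → ℝ} (ha : a ∈ E8) : ∑ i, a i ^ 2 = 2 := by
  rcases ha with ⟨i, j, hij, ε, δ, hε, hδ, rfl⟩ | ⟨s, -, rfl⟩
  · have : ∀ k, (Pi.single i ε + Pi.single j δ : Fin 8 → ℝ) k ^ 2 =
        (if k = i then ε ^ 2 else 0) + if k = j then δ ^ 2 else 0 := by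
      intro k
      by_cases h : k = i
      · subst h; simp [hij]
      · by_cases h' : k = j
        · subst h'; simp [h]
        · simp [h, h']
    rw [Finset.sum_congr rfl fun k _ => this k, Finset.sum_add_distrib]
    rcases hε with rfl | rfl <;> rcases hδ with rfl | rfl <;> simp <;> norm_num
  · have : ∀ k : Fin 8, (if k ∈ s then -1 / 2 else 1 / 2 : ℝ) ^ 2 = 1 / 4 := by
      intro k; split_ifs <;> norm_num
    rw [Finset.sum_congr rfl fun k _ => this k]
    norm_num

theorem exists_int_add_sub_of_mem_E8 {a : Fin 8 → ℝ} (ha : a ∈ E8) (k l : Fin 8) :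
    (∃ n : ℤ, a k + a l = n) ∧ ∃ n : ℤ, a k - a l = n := by
  rcases ha with ⟨i, j, -, ε, δ, hε, hδ, rfl⟩ | ⟨s, -, rfl⟩
  · have key : ∀ k, ∃ n : ℤ, (Pi.single i ε + Pi.single j δ : Fin 8 → ℝ) k = n := by
      have hsingle : ∀ (i k : Fin 8) (ε : ℝ), ε = 1 ∨ ε = -1 →
          ∃ n : ℤ, (Pi.single i ε : Fin 8 → ℝ) k = n := by
        intro i k ε hε
        by_cases h : k = i
        · subst h
          rcases hε with rfl | rfl
          · exact ⟨1, by simp⟩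
          · exact ⟨-1, by simp⟩
        · exact ⟨0, by simp [h]⟩
      intro k
      obtain ⟨m, hm⟩ := hsingle i k ε hε
      obtain ⟨n, hn⟩ := hsingle j k δ hδ
      exact ⟨m + n, by rw [Pi.add_apply, hm, hn]; push_cast; rfl⟩
    obtain ⟨m, hm⟩ := key k
    obtain ⟨n, hn⟩ := key l
    exact ⟨⟨m + n, by rw [hm, hn]; push_cast; rfl⟩, ⟨m - n, by rw [hm, hn]; push_cast; rfl⟩⟩
  · by_cases hk : k ∈ s <;> by_cases hl : l ∈ s <;> simp only [hk, hl, if_true, if_false]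
    · exact ⟨⟨-1, by norm_num⟩, ⟨0, by norm_num⟩⟩
    · exact ⟨⟨0, by norm_num⟩, ⟨-1, by norm_num⟩⟩
    · exact ⟨⟨0, by norm_num⟩, ⟨1, by norm_num⟩⟩
    · exact ⟨⟨1, by norm_num⟩, ⟨0, by norm_num⟩⟩

theorem exists_int_sum_pair_mul {a : Fin 8 → ℝ} (ha : a ∈ E8) (i j : Fin 8) {ε δ : ℝ}
    (hε : ε = 1 ∨ ε = -1) (hδ : δ = 1 ∨ δ = -1) :
    ∃ n : ℤ, ∑ k, (Pi.single i ε + Pi.single j δ : Fin 8 → ℝ) k * a k = n := by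
  have h : ∑ k, (Pi.single i ε + Pi.single j δ : Fin 8 → ℝ) k * a k = ε * a i + δ * a j := by
    simp [Pi.single_apply, add_mul, Finset.sum_add_distrib]
  obtain ⟨⟨m, hm⟩, ⟨n, hn⟩⟩ := exists_int_add_sub_of_mem_E8 ha i j
  rw [h]
  rcases hε with rfl | rfl <;> rcases hδ with rfl | rfl
  · exact ⟨m, by linarith⟩
  · exact ⟨n, by linarith⟩
  · exact ⟨-n, by push_cast; linarith⟩
  · exact ⟨-m, by push_cast; linarith⟩

/-- The `E₈` lattice is integral. -/
theorem exists_int_sum_mul {a b : Fin 8 → ℝ} (ha : a ∈ E8) (hb : b ∈ E8) :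
    ∃ n : ℤ, ∑ i, b i * a i = n := by
  rcases id hb with ⟨i, j, -, ε, δ, hε, hδ, rfl⟩ | ⟨t, ht, rfl⟩
  · exact exists_int_sum_pair_mul ha i j hε hδ
  rcases ha with ⟨i, j, -, ε, δ, hε, hδ, rfl⟩ | ⟨s, hs, rfl⟩
  · simpa only [mul_comm] using exists_int_sum_pair_mul hb i j hε hδ
  -- The two vectors differ in sign exactly on the symmetric difference, which has even size.
  obtain ⟨p, hp⟩ := hs
  obtain ⟨q, hq⟩ := ht
  have hcard : ∑ i : Fin 8, (if i ∈ t then -1 / 2 else 1 / 2 : ℝ) *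
      (if i ∈ s then -1 / 2 else 1 / 2) =
      2 - (s.card + t.card - 2 * (s ∩ t).card) / 2 := by
    have : ∀ i : Fin 8, (if i ∈ t then -1 / 2 else 1 / 2 : ℝ) * (if i ∈ s then -1 / 2 else 1 / 2) =
        1 / 4 - ((if i ∈ s then 1 else 0) + (if i ∈ t then 1 else 0) -
          2 * (if i ∈ s ∩ t then 1 else 0)) / 2 := by
      intro i
      by_cases h : i ∈ s <;> by_cases h' : i ∈ t <;> simp [h, h'] <;> norm_num
    rw [Finset.sum_congr rfl fun i _ => this i, Finset.sum_sub_distrib,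
      ← Finset.sum_div _ _ (2 : ℝ), Finset.sum_sub_distrib, Finset.sum_add_distrib,
      ← Finset.mul_sum]
    simp only [Finset.sum_ite_mem, Finset.univ_inter, Finset.sum_const, nsmul_eq_mul, mul_one]
    norm_num
  refine ⟨2 - p - q + (s ∩ t).card, ?_⟩
  rw [hcard, hp, hq]
  push_cast
  ring

/-- By the equality case of the Cauchy–Schwarz inequality an inner product of two vectors of `E8`
is `± 2` only for `b = ± a`, which the linear form `Y₇ - Y₈` rules out here. -/
theorem sum_mul_of_mem {a b : Fin 8 → ℝ} (ha : a ∈ E7) (hb : b ∈ cubicVectors) :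
    ∑ i, b i * a i = 0 ∨ ∑ i, b i * a i = 1 ∨ ∑ i, b i * a i = -1 := by
  obtain ⟨n, hn⟩ := exists_int_sum_mul ha.1 hb.1
  have hpos : ∀ σ : ℝ, 0 < ∑ i, (b i + σ * a i) ^ 2 := by
    intro σ
    refine (Finset.sum_nonneg fun i _ => sq_nonneg _).lt_of_ne' fun h => ?_
    rw [Finset.sum_eq_zero_iff_of_nonneg fun i _ => sq_nonneg _] at h
    have h6 := pow_eq_zero_iff two_ne_zero |>.1 (h 6 (Finset.mem_univ _))
    have h7 := pow_eq_zero_iff two_ne_zero |>.1 (h 7 (Finset.mem_univ _))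
    have hb2 := hb.2
    rw [ha.2] at h6
    linarith
  have hexp : ∀ σ : ℝ, ∑ i, (b i + σ * a i) ^ 2 = 2 + 2 * σ * n + σ ^ 2 * 2 := by
    intro σ
    have h : ∑ i, (b i + σ * a i) ^ 2 =
        ∑ i, b i ^ 2 + 2 * σ * ∑ i, b i * a i + σ ^ 2 * ∑ i, a i ^ 2 := by
      rw [Finset.mul_sum, Finset.mul_sum, ← Finset.sum_add_distrib, ← Finset.sum_add_distrib]
      exact Finset.sum_congr rfl fun i _ => by ring
    rw [h, hn, sum_sq_of_mem_E8 hb.1, sum_sq_of_mem_E8 ha.1]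
  have h1 := hpos 1
  have h2 := hpos (-1)
  rw [hexp] at h1 h2
  have h3 : -2 < n := by exact_mod_cast (by linarith : (-2 : ℝ) < n)
  have h4 : n < 2 := by exact_mod_cast (by linarith : (n : ℝ) < 2)
  rw [hn]
  have : n = 0 ∨ n = 1 ∨ n = -1 := by omega
  exact_mod_cast this

theorem pairVector_injOn :
    Set.InjOn (pairVector (R := ℝ)) {p | p.1 < p.2.1 ∧ p.2.2.1 ≠ 0 ∧ p.2.2.2 ≠ 0} := by
  rintro ⟨i, j, ε, δ⟩ ⟨hij, hε, hδ⟩ ⟨i', j', ε', δ'⟩ ⟨hij', hε', hδ'⟩ h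
  dsimp only at hij hε hδ hij' hε' hδ'
  have supp : ∀ {i j : Fin 8} {ε δ : ℝ}, i < j → ε ≠ 0 → δ ≠ 0 → ∀ k,
      pairVector (i, j, ε, δ) k ≠ 0 ↔ k = i ∨ k = j := by
    intro i j ε δ hij hε hδ k
    by_cases hi : k = i
    · subst hi; simp [pairVector, hij.ne, hε]
    · by_cases hj : k = j
      · subst hj; simp [pairVector, hij.ne', hδ]
      · simp [pairVector, hi, hj]
  have hk : ∀ k, (k = i ∨ k = j) ↔ (k = i' ∨ k = j') := fun k => by
    rw [← supp hij hε hδ, h, supp hij' hε' hδ']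
  have hi : i = i' := by
    have h1 := (hk i).1 (Or.inl rfl)
    have h2 := (hk i').2 (Or.inl rfl)
    have h3 := (hk j).1 (Or.inr rfl)
    omega
  have hj : j = j' := by
    have h1 := (hk j).1 (Or.inr rfl)
    have h2 := (hk j').2 (Or.inr rfl)
    omega
  subst hi hj
  have h1 := congrFun h i
  have h2 := congrFun h j
  simp [pairVector, hij.ne, hij.ne'] at h1 h2
  rw [h1, h2]

theorem halfVector_injective : Function.Injective halfVector := by
  have key : ∀ s i, i ∈ s ↔ halfVector s i = -1 / 2 := by
    intro s i
    by_cases h : i ∈ s <;> simp [halfVector, h]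
    norm_num
  intro s t h
  ext i
  rw [key, key, h]

/-- The index set of the vectors `± e_i ± e_j` with `i < j` on which `Y₇ - Y₈` takes the
value `c`. -/
def pairIndices (c : ℤ) : Finset (Fin 8 × Fin 8 × ℤ × ℤ) :=
  (Finset.univ ×ˢ Finset.univ ×ˢ {1, -1} ×ˢ {1, -1}).filter fun p =>
    p.1 < p.2.1 ∧ pairVector p 6 - pairVector p 7 = c

/-- The index set of the vectors `(± 1/2, …, ± 1/2)` with an even number of minus signs on which
`Y₇ - Y₈` takes the value `c`. -/
def halfIndices (c : ℤ) : Finset (Finset (Fin 8)) :=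
  Finset.univ.filter fun s =>
    Even s.card ∧ (if 6 ∈ s then -1 else 1) - (if 7 ∈ s then -1 else 1) = 2 * c

/-- The ordered pairs `i < j` with their signs and the even sign patterns parametrize `E8` without
repetition. -/
theorem ncard_E8_section (c : ℤ) :
    {a | a ∈ E8 ∧ a 6 - a 7 = c}.ncard = (pairIndices c).card + (halfIndices c).card := by
  let castIndex : Fin 8 × Fin 8 × ℤ × ℤ → Fin 8 × Fin 8 × ℝ × ℝ :=
    fun p => (p.1, p.2.1, p.2.2.1, p.2.2.2)
  have hcast : ∀ p k, pairVector (castIndex p) k = (pairVector p k : ℤ) := by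
    intro p k
    simp [pairVector, castIndex, Pi.single_apply, apply_ite (Int.cast : ℤ → ℝ)]
  have hmem : ∀ p, p ∈ pairIndices c ↔ (p.2.2.1 = 1 ∨ p.2.2.1 = -1) ∧
      (p.2.2.2 = 1 ∨ p.2.2.2 = -1) ∧ p.1 < p.2.1 ∧ pairVector p 6 - pairVector p 7 = c := by
    intro p
    simp [pairIndices, and_assoc]
  have hhalf : ∀ s : Finset (Fin 8), (halfVector s 6 - halfVector s 7 = c ↔
      ((if 6 ∈ s then -1 else 1) - (if 7 ∈ s then -1 else 1) : ℤ) = 2 * c) := by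
    intro s
    rw [← Int.cast_inj (α := ℝ)]
    by_cases h6 : 6 ∈ s <;> by_cases h7 : 7 ∈ s <;>
      simp only [halfVector, h6, h7, if_true, if_false] <;> push_cast <;>
      constructor <;> intro h <;> linarith
  have hset : {a | a ∈ E8 ∧ a 6 - a 7 = c} =
      (pairVector ∘ castIndex) '' pairIndices c ∪ halfVector '' halfIndices c := by
    ext a
    constructor
    · rintro ⟨⟨i, j, hij, ε, δ, hε, hδ, rfl⟩ | ⟨s, hs, rfl⟩, h⟩
      · left
        have hint : ∀ ε : ℝ, ε = 1 ∨ ε = -1 → ∃ m : ℤ, (m = 1 ∨ m = -1) ∧ (m : ℝ) = ε := by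
          rintro _ (rfl | rfl)
          · exact ⟨1, by simp⟩
          · exact ⟨-1, by simp⟩
        obtain ⟨m, hm, rfl⟩ := hint ε hε
        obtain ⟨n, hn, rfl⟩ := hint δ hδ
        rcases hij.lt_or_gt with hlt | hlt
        · refine ⟨(i, j, m, n), (hmem _).2 ⟨hm, hn, hlt, ?_⟩, rfl⟩
          rw [← Int.cast_inj (α := ℝ), Int.cast_sub, ← hcast, ← hcast]
          exact h
        · refine ⟨(j, i, n, m), (hmem _).2 ⟨hn, hm, hlt, ?_⟩, add_comm _ _⟩
          rw [← Int.cast_inj (α := ℝ), Int.cast_sub, ← hcast, ← hcast]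
          rw [add_comm] at h
          exact h
      · exact Or.inr ⟨s, by simpa [halfIndices, hs] using (hhalf s).1 h, rfl⟩
    · rintro (⟨p, hp, rfl⟩ | ⟨s, hs, rfl⟩)
      · obtain ⟨hm, hn, hlt, h⟩ := (hmem p).1 hp
        refine ⟨Or.inl ⟨p.1, p.2.1, hlt.ne, p.2.2.1, p.2.2.2, ?_, ?_, rfl⟩, ?_⟩
        · exact_mod_cast hm
        · exact_mod_cast hn
        · rw [Function.comp_apply, hcast, hcast, ← h, Int.cast_sub]
      · have hs' := (Finset.mem_filter.1 (Finset.mem_coe.1 hs)).2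
        exact ⟨Or.inr ⟨s, hs'.1, rfl⟩, (hhalf s).2 hs'.2⟩
  have hdisj : Disjoint ((pairVector ∘ castIndex) '' pairIndices c)
      (halfVector '' halfIndices c) := by
    rw [Set.disjoint_left]
    rintro _ ⟨p, -, rfl⟩ ⟨s, -, h⟩
    have h0 := congrFun h 0
    rw [Function.comp_apply, hcast] at h0
    -- Twice an integer is not `± 1`.
    have h1 : 2 * pairVector p 0 = if 0 ∈ s then -1 else 1 := by
      rw [← Int.cast_inj (α := ℝ), Int.cast_mul, ← h0]
      by_cases h : 0 ∈ s <;> simp [halfVector, h]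
      norm_num
    split_ifs at h1 <;> omega
  have hinj : Set.InjOn (pairVector ∘ castIndex) (pairIndices c) := by
    refine pairVector_injOn.comp ?_ ?_
    · rintro ⟨i, j, m, n⟩ - ⟨i', j', m', n'⟩ - h
      simpa [castIndex] using h
    · intro p hp
      obtain ⟨hm, hn, hlt, -⟩ := (hmem p).1 hp
      refine ⟨hlt, ?_, ?_⟩ <;> simp only [castIndex, ne_eq, Int.cast_eq_zero] <;> omega
  rw [hset, Set.ncard_union_eq hdisj (Set.toFinite _) (Set.toFinite _),
    hinj.ncard_image, Set.ncard_image_of_injective _ halfVector_injective,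
    Set.ncard_coe_finset, Set.ncard_coe_finset]

theorem ncard_E7 : E7.ncard = 126 := by
  have h : E7 = {a | a ∈ E8 ∧ a 6 - a 7 = (0 : ℤ)} := by
    ext a; simp [E7, sub_eq_zero]
  rw [h, ncard_E8_section]
  decide +kernel

theorem ncard_cubicVectors : cubicVectors.ncard = 56 := by
  have h : cubicVectors = {a | a ∈ E8 ∧ a 6 - a 7 = (1 : ℤ)} := by
    ext a; simp [cubicVectors]
  rw [h, ncard_E8_section]
  decide +kernel

/-! ### The zero set of the cubics -/

theorem restrict_Nm_mem : restrict Nm ∈ cubicIdeal :=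
  Ideal.subset_span (Set.mem_insert _ _)

theorem restrict_cubic_mem {b : Fin 8 → ℝ} (hb : b ∈ cubicVectors) :
    restrict (cubic b) ∈ cubicIdeal :=
  Ideal.subset_span (Set.mem_insert_of_mem _ ⟨b, hb, rfl⟩)

theorem E7InT_subset_zeroLocus : E7InT ⊆ zeroLocus ℂ cubicIdeal := by
  rintro y ⟨a, ha, hy⟩
  rw [cubicIdeal, zeroLocus_span]
  rintro _ (rfl | ⟨b, hb, rfl⟩)
  · rw [aeval_restrict_Nm, sub_eq_zero]
    simp only [hy]
    exact_mod_cast sum_sq_of_mem_E8 ha.1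
  · have h : ∑ i, (b i : ℂ) * y (hyperplaneIndex i) = ((∑ i, b i * a i : ℝ) : ℂ) := by
      simp [hy]
    dsimp only
    rw [aeval_restrict_cubic, h]
    rcases sum_mul_of_mem ha hb with h | h | h <;> rw [h] <;> simp

theorem sum_eq_of_mem_zeroLocus {y : Fin 7 → ℂ} (hy : y ∈ zeroLocus ℂ cubicIdeal)
    {b : Fin 8 → ℝ} (hb : b ∈ cubicVectors) :
    ∑ i, (b i : ℂ) * y (hyperplaneIndex i) = 0 ∨ ∑ i, (b i : ℂ) * y (hyperplaneIndex i) = 1 ∨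
      ∑ i, (b i : ℂ) * y (hyperplaneIndex i) = -1 := by
  have h := hy _ (restrict_cubic_mem hb)
  rw [aeval_restrict_cubic, mul_eq_zero, mul_eq_zero, sub_eq_zero, add_eq_zero_iff_eq_neg] at h
  tauto

/-- The cubics of the vectors `e₇ ± e_i` determine the coordinates `y₇` and `y_i` up to
finitely many choices. -/
theorem coordinates_of_mem_zeroLocus {y : Fin 7 → ℂ} (hy : y ∈ zeroLocus ℂ cubicIdeal)
    {i : Fin 7} (hi : i ≠ 6) :
    (y 6 = 0 ∧ (y i = 0 ∨ y i = 1 ∨ y i = -1)) ∨ ((y 6 = 1 ∨ y 6 = -1) ∧ y i = 0) ∨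
      ((y 6 = 1 / 2 ∨ y 6 = -1 / 2) ∧ (y i = 1 / 2 ∨ y i = -1 / 2)) := by
  have h1 := sum_eq_of_mem_zeroLocus hy (pair_mem_cubicVectors hi (Or.inl rfl))
  have h2 := sum_eq_of_mem_zeroLocus hy (pair_mem_cubicVectors hi (Or.inr rfl))
  rw [sum_pair_mul y i hi] at h1 h2
  push_cast at h1 h2
  have of_sum : ∀ {u v : ℂ}, 1 * y i + y 6 = u → -1 * y i + y 6 = v →
      y 6 = (u + v) / 2 ∧ y i = (u - v) / 2 := by
    intro u v hu hv
    constructor <;> rw [← hu, ← hv] <;> ring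
  rcases h1 with h1 | h1 | h1 <;> rcases h2 with h2 | h2 | h2 <;>
    obtain ⟨h6, hi⟩ := of_sum h1 h2 <;> rw [h6, hi] <;> norm_num

/-- A zero with all coordinates `± 1/2` has an even number of negative entries among the first
six. -/
theorem even_card_of_half_mem_zeroLocus {s : Finset (Fin 7)}
    (hy : (fun i => if i ∈ s then -1 / 2 else 1 / 2 : Fin 7 → ℂ) ∈ zeroLocus ℂ cubicIdeal) :
    Even (s.erase 6).card := by
  by_contra hs
  have key : ∀ s : Finset (Fin 7), ¬ Even (s.erase 6).card →
      Even (Finset.univ.filter fun k => k = 7 ∨ k ≠ 6 ∧ hyperplaneIndex k ∈ s).card := by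
    decide +kernel
  -- The vector `b` has the signs of `y` in the first six coordinates, so that `b · y = 6 / 4`.
  have hb : (fun k => if k ∈ (Finset.univ.filter fun k => k = 7 ∨ k ≠ 6 ∧ hyperplaneIndex k ∈ s)
      then -1 / 2 else 1 / 2 : Fin 8 → ℝ) ∈ cubicVectors :=
    ⟨Or.inr ⟨_, key s hs, rfl⟩, by simp; norm_num⟩
  have h := sum_eq_of_mem_zeroLocus hy hb
  have hsq : ∀ k : Fin 7, ((if k ∈ s then -1 / 2 else 1 / 2 : ℝ) : ℂ) *
      (if k ∈ s then -1 / 2 else 1 / 2) = 1 / 4 := by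
    intro k; split_ifs <;> norm_num
  have hsum : ∑ k : Fin 8, ((if k ∈ (Finset.univ.filter
      fun k => k = 7 ∨ k ≠ 6 ∧ hyperplaneIndex k ∈ s) then -1 / 2 else 1 / 2 : ℝ) : ℂ) *
        (if hyperplaneIndex k ∈ s then -1 / 2 else 1 / 2) = 3 / 2 := by
    have h6 : ((-1 / 2 : ℝ) : ℂ) = -((1 / 2 : ℝ) : ℂ) := by norm_num
    have hne : ∀ k : Fin 6, k.castSucc.castSucc ≠ 7 ∧ k.castSucc.castSucc ≠ 6 := by decide
    have hlast : hyperplaneIndex 7 = 6 ∧ hyperplaneIndex 6 = 6 ∧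
        Fin.last 7 = 7 ∧ (Fin.last 6).castSucc = 6 ∧ (6 : Fin 8) ≠ 7 := by decide
    rw [Fin.sum_univ_castSucc, Fin.sum_univ_castSucc]
    simp only [hlast.2.2.1, hlast.2.2.2.1, hlast.1, hlast.2.1]
    simp only [Finset.mem_filter, Finset.mem_univ, true_and, hne, hlast.2.2.2.2, false_or, ne_eq,
      not_false_eq_true, not_true, false_and, if_true, if_false, true_or, hsq, h6]
    simp
    split_ifs <;> norm_num
  rw [hsum] at h
  norm_num at h

theorem zeroLocus_subset_E7InT : zeroLocus ℂ cubicIdeal ⊆ E7InT := by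
  intro y hy
  have hcoord := fun {i : Fin 7} (hi : i ≠ 6) => coordinates_of_mem_zeroLocus hy hi
  have hne : ∀ k : Fin 7, k ≠ 6 ∨ k = 6 := fun k => (eq_or_ne k 6).symm
  rcases hcoord (i := 0) (by decide) with ⟨h6, -⟩ | ⟨h6, -⟩ | ⟨h6, -⟩
  · -- The squares `y_i²` are `0` or `1` and add up to `2`.
    have hy' : ∀ i, y i = 0 ∨ y i = 1 ∨ y i = -1 := by
      intro i
      rcases hne i with hi | rfl
      · have := hcoord hi
        rw [h6] at this
        norm_num at this
        exact this
      · exact Or.inl h6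
    have hcard : (Finset.univ.filter fun i => y i ≠ 0).card = 2 := by
      have h := hy _ restrict_Nm_mem
      rw [aeval_restrict_Nm, sub_eq_zero, Fin.sum_univ_castSucc] at h
      have h7 : hyperplaneIndex (Fin.last 7) = 6 := rfl
      have hi : ∀ k : Fin 7, hyperplaneIndex k.castSucc = k := by decide
      have hsq : ∀ k, y k ^ 2 = if y k ≠ 0 then 1 else 0 := by
        intro k
        rcases hy' k with h | h | h <;> simp [h]
      simp only [h7, h6, hi, hsq] at h
      rw [← Finset.sum_filter] at h
      simp at h
      exact_mod_cast h
    obtain ⟨i, j, hij, hs⟩ := Finset.card_eq_two.1 hcard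
    have hmem : ∀ k, y k ≠ 0 ↔ k = i ∨ k = j := by
      intro k
      have := Finset.ext_iff.1 hs k
      simpa using this
    have hreal : ∀ k, y k ≠ 0 → ∃ ε : ℝ, (ε = 1 ∨ ε = -1) ∧ y k = ε := by
      intro k hk
      rcases hy' k with h | h | h
      · exact absurd h hk
      · exact ⟨1, by simp, by simp [h]⟩
      · exact ⟨-1, by simp, by simp [h]⟩
    have hi0 := (hmem i).2 (Or.inl rfl)
    have hj0 := (hmem j).2 (Or.inr rfl)
    obtain ⟨ε, hε, hiε⟩ := hreal i hi0
    obtain ⟨δ, hδ, hjδ⟩ := hreal j hj0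
    have hi6 : i ≠ 6 := by rintro rfl; exact hi0 h6
    have hj6 : j ≠ 6 := by rintro rfl; exact hj0 h6
    convert! pair_mem_E7InT hi6 hj6 hij hε hδ
    ext k
    by_cases hki : k = i
    · subst hki; simp [hij, hiε]
    · by_cases hkj : k = j
      · subst hkj; simp [hki, hjδ]
      · have := (hmem k).not_right.2 (by tauto)
        simp [hki, hkj, this]
  · have hy0 : ∀ i, i ≠ 6 → y i = 0 := by
      intro i hi
      have := hcoord hi
      rcases h6 with h6 | h6 <;> rw [h6] at this <;> norm_num at this <;> exact this
    have key : ∀ ε : ℝ, (ε = 1 ∨ ε = -1) → y 6 = ε → y ∈ E7InT := by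
      intro ε hε h
      convert! single_mem_E7InT hε
      ext k
      rcases hne k with hk | rfl
      · simp [hk, hy0 k hk]
      · simp [h]
    rcases h6 with h6 | h6
    · exact key 1 (by simp) (by simp [h6])
    · exact key (-1) (by simp) (by simp [h6])
  · have hy' : ∀ i, y i = 1 / 2 ∨ y i = -1 / 2 := by
      intro i
      rcases hne i with hi | rfl
      · have := hcoord hi
        rcases h6 with h6 | h6 <;> rw [h6] at this <;> norm_num at this ⊢ <;> exact this
      · exact h6
    have hys : y = fun i => if i ∈ Finset.univ.filter (fun i => y i = -1 / 2)
        then -1 / 2 else 1 / 2 := by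
      ext i
      rcases hy' i with h | h <;> simp [h]
    rw [hys] at hy ⊢
    exact half_mem_E7InT (even_card_of_half_mem_zeroLocus hy)

theorem zeroLocus_cubicIdeal : zeroLocus ℂ cubicIdeal = E7InT :=
  zeroLocus_subset_E7InT.antisymm E7InT_subset_zeroLocus

/-! ### The ideal of the root system -/

/-- The cubics of `e₇ + e_i` and `e₇ - e_i` lie in the ideal, so the differentials of `Y₇ ± Y_i`
vanish in the quotient, hence so do those of all the coordinates. -/
theorem isRadical_cubicIdeal : cubicIdeal.IsRadical := by
  refine isRadical_of_derivation_eq_zero _ fun i => ?_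
  set D := KaehlerDifferential.D ℂ (MvPolynomial (Fin 7) ℂ ⧸ cubicIdeal)
  let x : Fin 7 → MvPolynomial (Fin 7) ℂ ⧸ cubicIdeal :=
    fun i => Ideal.Quotient.mk cubicIdeal (X i)
  have hform : ∀ (i : Fin 7) (hi : i ≠ 6) (ε : ℝ), restrict (linearForm
      (Pi.single i.castSucc ε + Pi.single 6 1)) = C (ε : ℂ) * X i + X 6 := by
    intro i hi ε
    have hi' : hyperplaneIndex i.castSucc = i := by revert i; decide
    have h6 : hyperplaneIndex 6 = 6 := rfl
    simp [linearForm, restrict, Pi.single_apply, add_mul, Finset.sum_add_distrib, hi', h6,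
      apply_ite (Complex.ofReal), apply_ite (C : ℂ → MvPolynomial (Fin 7) ℂ)]
  have hD : ∀ (i : Fin 7) (hi : i ≠ 6) (ε : ℝ), ε = 1 ∨ ε = -1 →
      (ε : ℂ) • D (x i) + D (x 6) = 0 := by
    intro i hi ε hε
    have h := Ideal.Quotient.eq_zero_iff_mem.2 (restrict_cubic_mem (pair_mem_cubicVectors hi hε))
    simp only [cubic, map_mul, map_sub, map_add, map_one, hform i hi] at h
    simp only [← map_mul, ← map_add] at h
    have := derivation_eq_zero_of_cubic_eq_zero D h
    rw [← smul_eq_C_mul, map_add, map_add] at this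
    have hsmul : Ideal.Quotient.mk cubicIdeal ((ε : ℂ) • X i) = (ε : ℂ) • x i := rfl
    rwa [hsmul, D.map_smul] at this
  have hzero : ∀ i : Fin 7, i ≠ 6 → D (x i) = 0 ∧ D (x 6) = 0 := by
    intro i hi
    have h1 := hD i hi 1 (Or.inl rfl)
    have h2 := hD i hi (-1) (Or.inr rfl)
    rw [Complex.ofReal_one, one_smul] at h1
    rw [Complex.ofReal_neg, Complex.ofReal_one, neg_one_smul] at h2
    have h6 : (2 : ℂ) • D (x 6) = 0 := by
      have : (2 : ℂ) • D (x 6) = (D (x i) + D (x 6)) + (-D (x i) + D (x 6)) := by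
        rw [two_smul]
        abel
      rw [this, h1, h2, add_zero]
    have h6' := (smul_eq_zero.1 h6).resolve_left two_ne_zero
    rw [h6', add_zero] at h1
    exact ⟨h1, h6'⟩
  by_cases hi : i = 6
  · rw [hi]
    exact (hzero 0 (by decide)).2
  · exact (hzero i hi).1

theorem idealOfE7_eq_cubicIdeal : idealOfE7 = cubicIdeal := by
  rw [idealOfE7, ← zeroLocus_cubicIdeal, vanishingIdeal_zeroLocus_eq_radical,
    isRadical_cubicIdeal.radical]

theorem totalDegree_restrict_le (p : MvPolynomial (Fin 8) ℂ) :
    (restrict p).totalDegree ≤ p.totalDegree :=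
  totalDegree_rename_le _ _

theorem totalDegree_Nm_le : Nm.totalDegree ≤ 2 := by
  refine (totalDegree_sub_C_le _ _).trans ?_
  refine totalDegree_finsetSum_le fun i _ => ?_
  rw [totalDegree_X_pow]

theorem totalDegree_cubic_le (b : Fin 8 → ℝ) : (cubic b).totalDegree ≤ 3 := by
  have h : (linearForm b).totalDegree ≤ 1 := by
    refine totalDegree_finsetSum_le fun i _ => (totalDegree_mul _ _).trans ?_
    rw [totalDegree_C, totalDegree_X]
  have h1 : (1 : MvPolynomial (Fin 8) ℂ).totalDegree = 0 := totalDegree_one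
  have hs := totalDegree_sub (linearForm b) 1
  have ha := totalDegree_add (linearForm b) 1
  have hm := totalDegree_mul ((linearForm b - 1) * linearForm b) (linearForm b + 1)
  have hm' := totalDegree_mul (linearForm b - 1) (linearForm b)
  rw [cubic]
  omega

/-! ### Polynomials of degree at most two -/

/-- A polynomial of degree at most two is a constant plus a linear form plus the quadratic form of
a symmetric matrix. -/
theorem exists_quadratic_of_totalDegree_le_two {σ : Type*} [Fintype σ] (F : MvPolynomial σ ℂ)
    (hF : F.totalDegree ≤ 2) :
    ∃ (c : ℂ) (l : σ → ℂ) (Q : σ → σ → ℂ), (∀ i j, Q i j = Q j i) ∧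
      F = C c + ∑ i, C (l i) * X i + ∑ i, ∑ j, C (Q i j) * X i * X j := by
  classical
  have hadd : ∀ s ⊆ F.support,
      ∃ (c : ℂ) (l : σ → ℂ) (Q : σ → σ → ℂ), (∀ i j, Q i j = Q j i) ∧
        ∑ m ∈ s, monomial m (F.coeff m) =
          C c + ∑ i, C (l i) * X i + ∑ i, ∑ j, C (Q i j) * X i * X j := by
    intro s
    induction s using Finset.induction_on with
    | empty => exact fun _ => ⟨0, 0, 0, by simp⟩
    | insert m s hm ih =>
      intro hs
      obtain ⟨c, l, Q, hQ, h⟩ := ih ((Finset.subset_insert _ _).trans hs)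
      rw [Finset.sum_insert hm, h]
      have hdeg : m.degree ≤ 2 := (le_totalDegree (hs (Finset.mem_insert_self m s))).trans hF
      generalize F.coeff m = a
      by_cases h0 : m = 0
      · refine ⟨a + c, l, Q, hQ, ?_⟩
        rw [h0, C_add, ← C_apply]
        ring
      obtain ⟨i, hi⟩ := Finsupp.ne_iff.1 h0
      obtain ⟨m', rfl⟩ := le_iff_exists_add.1
        (Finsupp.single_le_iff.2 (Nat.one_le_iff_ne_zero.2 hi))
      rw [map_add, Finsupp.degree_single] at hdeg
      by_cases h1 : m' = 0
      · refine ⟨c, Pi.single i a + l, Q, hQ, ?_⟩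
        have : ∑ k, C ((Pi.single i a + l : σ → ℂ) k) * X k = C a * X i + ∑ k, C (l k) * X k := by
          simp [add_mul, Finset.sum_add_distrib, Pi.single_apply,
            apply_ite (C : ℂ → MvPolynomial σ ℂ)]
        rw [this, h1, add_zero, C_mul_X_eq_monomial]
        ring
      · obtain ⟨j, hj⟩ := Finsupp.ne_iff.1 h1
        obtain ⟨m'', rfl⟩ := le_iff_exists_add.1
          (Finsupp.single_le_iff.2 (Nat.one_le_iff_ne_zero.2 hj))
        rw [map_add, Finsupp.degree_single] at hdeg
        have h2 : m'' = 0 := by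
          rw [← Finsupp.degree_eq_zero_iff]
          omega
        subst h2
        refine ⟨c, l, fun p q => (if p = i then if q = j then a / 2 else 0 else 0) +
          (if p = j then if q = i then a / 2 else 0 else 0) + Q p q, ?_, ?_⟩
        · intro p q
          dsimp only
          rw [hQ p q]
          split_ifs <;> simp
        · have : ∑ p, ∑ q, C ((if p = i then if q = j then a / 2 else 0 else 0) +
              (if p = j then if q = i then a / 2 else 0 else 0) + Q p q) * X p * X q =
              C (a / 2) * X i * X j + C (a / 2) * X j * X i + ∑ p, ∑ q, C (Q p q) * X p * X q := by
            simp [add_mul, Finset.sum_add_distrib, apply_ite (C : ℂ → MvPolynomial σ ℂ), ite_mul]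
          have hmon : (monomial (Finsupp.single i 1 + (Finsupp.single j 1 + 0))) a =
              C a * X i * X j := by
            rw [add_zero, C_mul_X_eq_monomial, X, monomial_mul, mul_one]
          have ha : (C a : MvPolynomial σ ℂ) = C (a / 2) + C (a / 2) := by rw [← C_add, add_halves]
          rw [this, hmon, ha]
          ring
  obtain ⟨c, l, Q, hQ, h⟩ := hadd F.support subset_rfl
  exact ⟨c, l, Q, hQ, by rw [← h]; exact F.as_sum⟩

/-- Vanishing at `± e_i ± e_j` and at `± (e₇ + e₈)` kills the linear part and the coefficients of
`Y_i Y_j` with `i < j ≤ 6`, and fixes those of the squares in terms of the constant; vanishing at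
the vectors `(± 1/2, …, ± 1/2)` kills the coefficients of `Y_i Y₇`. -/
theorem isTrivial_of_totalDegree_le_two {F : MvPolynomial (Fin 7) ℂ} (hF : F ∈ idealOfE7)
    (hdeg : F.totalDegree ≤ 2) : IsTrivial F := by
  obtain ⟨c, l, Q, hQ, rfl⟩ := exists_quadratic_of_totalDegree_le_two F hdeg
  obtain ⟨d, rfl⟩ : ∃ d, c = 2 * d := ⟨c / 2, by ring⟩
  have hev : ∀ y ∈ E7InT, 2 * d + ∑ i, l i * y i + ∑ i, ∑ j, Q i j * y i * y j = 0 := by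
    intro y hy
    simpa using hF y hy
  have hsingle : ∀ ε : ℝ, ε = 1 ∨ ε = -1 → 2 * d + l 6 * ε + Q 6 6 * ε * ε = 0 := by
    intro ε hε
    have h := hev _ (single_mem_E7InT hε)
    simpa [Pi.single_apply] using h
  have hpair : ∀ i j : Fin 7, i ≠ 6 → j ≠ 6 → i ≠ j → ∀ ε δ : ℝ, (ε = 1 ∨ ε = -1) →
      (δ = 1 ∨ δ = -1) → 2 * d + l i * ε + l j * δ + Q i i * ε * ε + 2 * Q i j * ε * δ +
        Q j j * δ * δ = 0 := by
    intro i j hi hj hij ε δ hε hδ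
    have h := hev _ (pair_mem_E7InT hi hj hij hε hδ)
    simp [Pi.single_apply, mul_add, add_mul, Finset.sum_add_distrib] at h
    rw [hQ j i] at h
    linear_combination h
  have hl6 : l 6 = 0 := by
    have h1 := hsingle 1 (by simp)
    have h2 := hsingle (-1) (by simp)
    push_cast at h1 h2
    linear_combination (h1 - h2) / 2
  have h66 : Q 6 6 = -(2 * d) := by
    have h1 := hsingle 1 (by simp)
    have h2 := hsingle (-1) (by simp)
    push_cast at h1 h2
    linear_combination (h1 + h2) / 2
  have hsigns : ∀ i j : Fin 7, i ≠ 6 → j ≠ 6 → i ≠ j →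
      l i = 0 ∧ Q i j = 0 ∧ Q i i + Q j j = -(2 * d) := by
    intro i j hi hj hij
    have h1 := hpair i j hi hj hij 1 1 (by simp) (by simp)
    have h2 := hpair i j hi hj hij 1 (-1) (by simp) (by simp)
    have h3 := hpair i j hi hj hij (-1) 1 (by simp) (by simp)
    have h4 := hpair i j hi hj hij (-1) (-1) (by simp) (by simp)
    push_cast at h1 h2 h3 h4
    refine ⟨?_, ?_, ?_⟩
    · linear_combination (h1 + h2 - h3 - h4) / 4
    · linear_combination (h1 - h2 - h3 + h4) / 8
    · linear_combination (h1 + h2 + h3 + h4) / 4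
  have hother : ∀ i : Fin 7, i ≠ 6 → ∃ j k : Fin 7, j ≠ 6 ∧ k ≠ 6 ∧ i ≠ j ∧ i ≠ k ∧ j ≠ k := by
    decide
  have hl : ∀ i, l i = 0 := by
    intro i
    by_cases hi : i = 6
    · rw [hi, hl6]
    · obtain ⟨j, -, hj, -, hij, -, -⟩ := hother i hi
      exact (hsigns i j hi hj hij).1
  have hdiag : ∀ i, i ≠ 6 → Q i i = -d := by
    intro i hi
    obtain ⟨j, k, hj, hk, hij, hik, hjk⟩ := hother i hi
    have h1 := (hsigns i j hi hj hij).2.2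
    have h2 := (hsigns i k hi hk hik).2.2
    have h3 := (hsigns j k hj hk hjk).2.2
    linear_combination (h1 + h2 - h3) / 2
  have hoff : ∀ i j, i ≠ 6 → j ≠ 6 → i ≠ j → Q i j = 0 := fun i j hi hj hij =>
    (hsigns i j hi hj hij).2.1
  have hQ6 : ∀ i, i ≠ 6 → Q 6 i = Q i 6 := fun i _ => hQ 6 i
  have hhalf : ∀ s : Finset (Fin 7), Even (s.erase 6).card → 6 ∉ s →
      ∑ i : Fin 6, Q i.castSucc 6 * (if i.castSucc ∈ s then -1 else 1) = 0 := by
    intro s hs h6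
    have h := hev _ (half_mem_E7InT hs)
    have hsq : ∀ i, (if i ∈ s then -1 / 2 else 1 / 2 : ℂ) = (if i ∈ s then -1 else 1) / 2 := by
      intro i; split_ifs <;> ring
    have hone : ∀ i, (if i ∈ s then -1 else 1 : ℂ) ^ 2 = 1 := by
      intro i; split_ifs <;> ring
    simp only [hsq] at h
    simp [Fin.sum_univ_seven, hl, hoff, hdiag, hQ6, h66, h6] at h
    simp only [Fin.sum_univ_six]
    change Q 0 6 * (if 0 ∈ s then -1 else 1) + Q 1 6 * (if 1 ∈ s then -1 else 1) +
      Q 2 6 * (if 2 ∈ s then -1 else 1) + Q 3 6 * (if 3 ∈ s then -1 else 1) +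
      Q 4 6 * (if 4 ∈ s then -1 else 1) + Q 5 6 * (if 5 ∈ s then -1 else 1) = 0
    linear_combination 2 * h + d / 2 * (hone 0 + hone 1 + hone 2 + hone 3 + hone 4 + hone 5)
  have h6 : ∀ i, i ≠ 6 → Q i 6 = 0 := by
    have hpm : ∀ i j : Fin 6, i ≠ j → Q i.castSucc 6 + Q j.castSucc 6 = 0 := by
      intro i j hij
      -- The relations of `∅` and of `{i, j}` differ by twice the entries at `i` and `j`.
      have h1 := hhalf ∅ (by simp) (by simp)
      have h2 := hhalf {i.castSucc, j.castSucc} (by revert i j; decide) (by revert i j; decide)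
      have hval : ∀ k : Fin 6, (if k.castSucc ∈ ({i.castSucc, j.castSucc} : Finset (Fin 7))
          then -1 else 1 : ℂ) = 1 - (if k = i then 2 else 0) - if k = j then 2 else 0 := by
        intro k
        by_cases hki : k = i
        · subst hki; simp [hij]; norm_num
        · by_cases hkj : k = j
          · subst hkj; simp [hki]; norm_num
          · simp [hki, hkj]
      simp only [hval, mul_sub, Finset.sum_sub_distrib] at h2
      simp at h1 h2
      rw [h1] at h2
      linear_combination -h2 / 2
    have h6' : ∀ i : Fin 6, Q i.castSucc 6 = 0 := by
      have hother : ∀ i : Fin 6, ∃ j k : Fin 6, i ≠ j ∧ i ≠ k ∧ j ≠ k := by decide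
      intro i
      obtain ⟨j, k, hij, hik, hjk⟩ := hother i
      linear_combination (hpm i j hij + hpm i k hik - hpm j k hjk) / 2
    intro i hi
    obtain ⟨k, rfl⟩ : ∃ k : Fin 6, k.castSucc = i := ⟨i.castPred hi, by simp⟩
    exact h6' k
  refine ⟨C (-d), ?_⟩
  have hC2 : (C 2 : MvPolynomial (Fin 7) ℂ) = 2 := map_ofNat C 2
  have hNm : restrict Nm = X 0 ^ 2 + X 1 ^ 2 + X 2 ^ 2 + X 3 ^ 2 + X 4 ^ 2 + X 5 ^ 2 + 2 * X 6 ^ 2 -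
      2 := by
    simp [restrict, Nm, Fin.sum_univ_eight, hyperplaneIndex, hC2]
    ring
  rw [hNm]
  simp [hC2, Fin.sum_univ_seven, hl, hoff, hdiag, hQ6, h66, h6]
  ring

theorem exists_cubic_not_isTrivial :
    ∃ F ∈ idealOfE7, ¬ IsTrivial F ∧ F.totalDegree = 3 := by
  have hb := pair_mem_cubicVectors (i := 0) (by decide) (Or.inl rfl)
  have hmem := restrict_cubic_mem hb
  have hnot : ¬ IsTrivial (restrict (cubic (Pi.single (Fin.castSucc 0) 1 + Pi.single 6 1))) := by
    rintro ⟨G, hG⟩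
    -- A point of the sphere on which `b · y = 4 / 3`.
    have h := congrArg (aeval (![2 / 3, 2 / 3, 1 / 3, 1 / 3, 0, 0, 2 / 3] : Fin 7 → ℂ)) hG
    rw [map_mul, aeval_restrict_cubic, aeval_restrict_Nm, sum_pair_mul _ _ (by decide)] at h
    simp [Fin.sum_univ_eight, hyperplaneIndex] at h
    norm_num at h
  rw [← idealOfE7_eq_cubicIdeal] at hmem
  refine ⟨_, hmem, hnot, le_antisymm ?_ ?_⟩
  · exact (totalDegree_restrict_le _).trans (totalDegree_cubic_le _)
  · by_contra h
    exact hnot (isTrivial_of_totalDegree_le_two hmem (by omega))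

end E7Ideal

theorem theorem3p2 :
    E7Ideal.E7.ncard = 126 ∧
    E7Ideal.cubicVectors.ncard = 56 ∧
    MvPolynomial.zeroLocus ℂ E7Ideal.cubicIdeal = E7Ideal.E7InT ∧
    E7Ideal.cubicIdeal.IsRadical ∧
    IsLeast {d : ℕ | ∃ F ∈ E7Ideal.idealOfE7, ¬ E7Ideal.IsTrivial F ∧ F.totalDegree = d} 3 ∧
    ∃ S : Set (MvPolynomial (Fin 7) ℂ),
      (∀ F ∈ S, F.totalDegree ≤ 3) ∧ Ideal.span S = E7Ideal.idealOfE7 := by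
  refine ⟨E7Ideal.ncard_E7, E7Ideal.ncard_cubicVectors, E7Ideal.zeroLocus_cubicIdeal,
    E7Ideal.isRadical_cubicIdeal, ⟨E7Ideal.exists_cubic_not_isTrivial, ?_⟩,
    _, ?_, E7Ideal.idealOfE7_eq_cubicIdeal.symm⟩
  · rintro d ⟨F, hF, hnot, rfl⟩
    by_contra h
    exact hnot (E7Ideal.isTrivial_of_totalDegree_le_two hF (by omega))
  · rintro _ (rfl | ⟨b, -, rfl⟩)
    · exact (E7Ideal.totalDegree_restrict_le _).trans
        (E7Ideal.totalDegree_Nm_le.trans (by norm_num))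
    · exact (E7Ideal.totalDegree_restrict_le _).trans (E7Ideal.totalDegree_cubic_le b)
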